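/- Let $n\ge 2$ and $1\le k\le n-1$, let $P\ge 0$ be an integer, let $B=P\left(k(n-1)-\frac{k(k-1)}{2}\right)$, and let $\mathbb{F}_q$ be a finite field. Let $\psi_1,\dots,\psi_n\in\mathbb{F}_q^{\,n-1}$ be such that every submatrix of the $(n-1)\times n$ matrix $[\psi_1\cdots\psi_n]$ has full rank. The product-matrix code stores a message of $B$ symbols of $\mathbb{F}_q$ in $n$ nodes as follows. The symbols are placed bijectively (in an arbitrary fixed way) in the free entries of symmetric $(n-1)\times(n-1)$ matrices $M_1,\dots,M_P$ whose bottom-right $(n-1-k)\times(n-1-k)$ blocks are zero (the free entries being the positions $(i,j)$ with $i\le j$ and $i\le k$), and node $\ell$ stores $\{\psi_\ell^T M_p\}_{p=1}^{P}$, i.e. $A=(n-1)P$ symbols. A regenerating code with parameters $(n,k,d)$ (functional repair, not necessarily linear, over arbitrary finite alphabets) stores a message in $n$ nodes so that, after any sequence of failures and repairs, the message is recoverable from any $k$ nodes, and any failed node can be replaced by contacting any $d$ other nodes, each of which sends a function of its own content taking values in a fixed finite alphabet. For a message of size $B$, a pair $(\alpha,\gamma)$ is feasible if some such code, with all sizes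 measured logarithmically in a common unit, stores a message of size at least $B$ with at most $\alpha$ per node and total download at most $\gamma$ per repair. The storage-bandwidth tradeoff consists of the points $(\alpha,\gamma)$ where $\alpha$ is the least storage for which $(\alpha,\gamma)$ is feasible, and the minimum-bandwidth-regenerating (MBR) point is its point with the least feasible $\gamma$. Then: (1) the whole message can be recovered from the data stored in any $k$ nodes; (2) the code is a regenerating code with parameters $(n,k,d=n-1)$ and exact repair: the content of any node can be restored by downloading $P$ symbols from each of the $n-1$ other nodes; thus it achieves $(\alpha,\gamma)=(A,A)$, in symbols of $\mathbb{F}_q$; (3) it is optimal for the storage-bandwidth tradeoff of Dimakis et al. with $d=n-1$: $(A,A)$ is the MBR point for $(n,k,d)$ and message size $B$, that is, $\gamma=A$ is the least feasible repair bandwidth, $\alpha=A$ is the least feasible storage at that bandwidth, and $$A=\frac{2B(n-1)}{2k(n-1)-k^2+k}.$$ -/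

import Mathlib

namespace ObliviousUpdate

/-! ### Distributed storage, functional repair and the storage-bandwidth tradeoff -/

section Regenerating

variable {ι Msg Sto : Type*}

/-- An encoding `c` assigns to every node `i` and every message `m` the content `c i m` of node `i`.
The message is recoverable from any `k` nodes if every set of `k` nodes has a decoder. -/
def RecoverableFromAny (k : ℕ) (c : ι → Msg → Sto) : Prop :=
  ∀ K : Finset ι, K.card = k →
    ∃ dec : (K → Sto) → Msg, ∀ m : Msg, dec (fun i => c i m) = m

/-- Node `f` fails and is replaced: every helper node in `H` sends one element of `Dl`, computed from
its own content, and the replacement computes its content from what it receives. The other nodes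
are unchanged, and `c'` is the encoding of the system after the repair. -/
def RepairsTo (Dl : Type*) (c c' : ι → Msg → Sto) (f : ι) (H : Finset ι) : Prop :=
  (∀ i, i ≠ f → c' i = c i) ∧
    ∃ (h : H → Sto → Dl) (g : (H → Dl) → Sto),
      ∀ m : Msg, c' f m = g (fun i => h i (c i m))

/-- A regenerating code with functional repair, given by the set `𝒞` of the encodings which the
system may go through: in each of them the message is recoverable from any `k` nodes, and each
failed node can be replaced with the help of any `d` other nodes, each sending one element of `Dl`,
such that the system stays in `𝒞` (so that failures and repairs may go on forever).
If `𝒞 = {c}`, the repair is exact: the lost content itself is restored. -/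
structure IsRegeneratingCode (k d : ℕ) (Dl : Type*) (𝒞 : Set (ι → Msg → Sto)) : Prop where
  nonempty : 𝒞.Nonempty
  recoverable : ∀ c ∈ 𝒞, RecoverableFromAny k c
  repairable : ∀ c ∈ 𝒞, ∀ (f : ι) (H : Finset ι), f ∉ H → H.card = d →
    ∃ c' ∈ 𝒞, RepairsTo Dl c c' f H

/-- Measured in units of information of `u` nats (`u = log q` for symbols of a field of size `q`),
the regenerating code `𝒞` stores a message of size (at least) `B`, with storage (at most) `α` per
node and a total download (at most) `γ` for the repair of one node. -/
def OperatesAt (k d : ℕ) (Dl : Type*) (𝒞 : Set (ι → Msg → Sto)) (u B α γ : ℝ) : Prop :=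
  IsRegeneratingCode k d Dl 𝒞 ∧
    u * B ≤ Real.log (Nat.card Msg) ∧
    Real.log (Nat.card Sto) ≤ u * α ∧
    d * Real.log (Nat.card Dl) ≤ u * γ

end Regenerating

/-- `(α, γ)` is feasible for a message of size `B` and `n` nodes: there is a regenerating code (with
functional repair, and not necessarily linear), over finite alphabets of any sizes, that achieves
it. -/
def Feasible (n k d : ℕ) (B α γ : ℝ) : Prop :=
  ∃ (a b e : ℕ) (𝒞 : Set (Fin n → Fin a → Fin b)) (u : ℝ),
    0 < u ∧ OperatesAt k d (Fin e) 𝒞 u B α γ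

/-- The storage-bandwidth tradeoff: `α` is the least storage per node with which the repair
bandwidth `γ` is feasible. -/
def OnTradeoff (n k d : ℕ) (B α γ : ℝ) : Prop :=
  IsLeast {α' : ℝ | Feasible n k d B α' γ} α

/-- The minimum-bandwidth-regenerating (MBR) point: the point of the tradeoff at which the repair
bandwidth is the least feasible one. -/
def IsMBRPoint (n k d : ℕ) (B α γ : ℝ) : Prop :=
  OnTradeoff n k d B α γ ∧ IsLeast {γ' : ℝ | ∃ α' : ℝ, Feasible n k d B α' γ'} γ

/-! ### The product-matrix code -/

/-- The free positions `(i, j)` of a symmetric `(n-1) × (n-1)` matrix whose bottom-right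
`(n-1-k) × (n-1-k)` submatrix is zero: those with `i ≤ j` in the first `k` rows. -/
abbrev FreePos (n k : ℕ) : Type :=
  {x : Fin (n - 1) × Fin (n - 1) // x.1 ≤ x.2 ∧ (x.1 : ℕ) < k}

variable {F : Type*}

/-- The symmetric matrix `M_p`, whose free position `x` is populated with the message symbol of
index `e (p, x)`. -/
def messageMatrix [Zero F] {n k B P : ℕ} (e : Fin P × FreePos n k ≃ Fin B) (m : Fin B → F)
    (p : Fin P) : Matrix (Fin (n - 1)) (Fin (n - 1)) F :=
  Matrix.of fun i j =>
    if h : ((min i j : Fin (n - 1)) : ℕ) < k then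
      m (e (p, ⟨(min i j, max i j), min_le_max, h⟩))
    else 0

/-- Every submatrix (with any set of rows and any set of columns) is of full rank. -/
def EverySubmatrixFullRank [CommRing F] {a b : ℕ} (Ψ : Matrix (Fin a) (Fin b) F) : Prop :=
  ∀ (I : Finset (Fin a)) (J : Finset (Fin b)),
    (Ψ.submatrix (fun i : I => (i : Fin a)) (fun j : J => (j : Fin b))).rank = min I.card J.card

/-- The product-matrix code: with `ψ_l` the `l`-th column of `Ψ`, node `l` stores the vectors
`ψ_lᵀ M_p` for all `p`, that is, `(n - 1) * P` symbols. -/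
def productMatrixCode [CommRing F] {n k B P : ℕ} (Ψ : Matrix (Fin (n - 1)) (Fin n) F)
    (e : Fin P × FreePos n k ≃ Fin B) (l : Fin n) (m : Fin B → F) : Fin P → Fin (n - 1) → F :=
  fun p => Matrix.vecMul (fun i => Ψ i l) (messageMatrix e m p)

end ObliviousUpdate

open ObliviousUpdate

/-!
# Optimality of the product-matrix code

**The code works.** Two facts about the message matrices `M` carry the code: `M` is symmetric, and
its bottom-right block vanishes. Full rank of the submatrices of `Ψ` says that a vector `v`
supported on a set `I` of rows is determined by its products with any `|I|` columns `ψ_l`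
(`EverySubmatrixFullRank.eq_zero_of_sum_eq_zero`).

* *Recovery.* Let `D` be a difference of two message matrices with the same content in `k` nodes.
  A column of `D` with index at least `k` is supported on the first `k` rows, so it is zero; by
  symmetry the other columns are then supported on the first `k` rows as well, and are zero too.
* *Exact repair.* For each `p` the helper `i` sends `ψ_iᵀ M_p ψ_f`; the `n - 1` received symbols
  determine `M_p ψ_f`, which by symmetry is the lost vector `ψ_fᵀ M_p`.

**Nothing does better.** This is the cut-set bound with `d = n - 1`. Let the nodes `0, …, k - 1`
fail one after the other, each being repaired by all the others. When node `t` is repaired, the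
contents of the nodes before it are known already, so that all that is new is contained in the
symbols that the `n - 1 - t` nodes after it send. Hence the final contents of these `k` nodes, and
with them the message, take at most `|Dl| ^ S` values, where `S = ∑_{t < k} (n - 1 - t)`. If the
first failure is skipped, the bound is `|Sto| * |Dl| ^ (S - (n - 1))`. As `B = P * S`, the first
bound gives the least repair bandwidth, and the second one the least storage at that bandwidth.
-/

namespace ObliviousUpdate

/-! ### The cut-set bound -/

section CutSet

variable {n : ℕ} {Msg Sto Dl : Type*}

/-- Some encoding in `𝒞` has the property that the contents of the nodes `0, …, t - 1` together are
a function of a quantity that takes at most `N` values. -/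
def HasSummary (𝒞 : Set (Fin n → Msg → Sto)) (t N : ℕ) : Prop :=
  ∃ c ∈ 𝒞, ∃ G : Msg → Fin N, ∀ m m', G m = G m' → ∀ i : Fin n, (i : ℕ) < t → c i m = c i m'

theorem hasSummary_zero {𝒞 : Set (Fin n → Msg → Sto)} (h : 𝒞.Nonempty) : HasSummary 𝒞 0 1 := by
  obtain ⟨c, hc⟩ := h
  exact ⟨c, hc, fun _ => 0, fun _ _ _ i hi => absurd hi (Nat.not_lt_zero _)⟩

theorem hasSummary_one [Finite Sto] {𝒞 : Set (Fin n → Msg → Sto)} (h : 𝒞.Nonempty) (hn : 0 < n) :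
    HasSummary 𝒞 1 (Nat.card Sto) := by
  obtain ⟨c, hc⟩ := h
  refine ⟨c, hc, fun m => Finite.equivFin Sto (c ⟨0, hn⟩ m), fun m m' hm i hi => ?_⟩
  have hi0 : i = ⟨0, hn⟩ := Fin.ext (by simpa using hi)
  simpa [hi0] using hm

theorem card_later_nodes (t : Fin n) : Nat.card {i : Fin n // t < i} = n - 1 - t := by
  rw [Nat.card_eq_fintype_card, Fintype.card_subtype, Finset.filter_lt_eq_Ioi, Fin.card_Ioi]

/-- Failure and repair of node `t`: given the contents of the nodes before it, the new content of
node `t` depends only on what the `n - 1 - t` nodes after it send. -/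
theorem HasSummary.succ [Finite Dl] {𝒞 : Set (Fin n → Msg → Sto)} {k t N : ℕ}
    (h𝒞 : IsRegeneratingCode k (n - 1) Dl 𝒞) (h : HasSummary 𝒞 t N) (ht : t < n) :
    HasSummary 𝒞 (t + 1) (N * Nat.card Dl ^ (n - 1 - t)) := by
  obtain ⟨c, hc, G, hG⟩ := h
  let f : Fin n := ⟨t, ht⟩
  have hf : f ∉ Finset.univ.erase f := Finset.notMem_erase _ _
  obtain ⟨c', hc', hkeep, snd, g, hg⟩ := h𝒞.repairable c hc f (Finset.univ.erase f) hf (by simp)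
  let X := Fin N × ({i : Fin n // f < i} → Dl)
  have hX : Nat.card X = N * Nat.card Dl ^ (n - 1 - t) := by
    rw [Nat.card_prod, Nat.card_fun, card_later_nodes, Nat.card_fin]
  let G' : Msg → X := fun m => (G m, fun i => snd ⟨i, by simpa using i.2.ne'⟩ (c i m))
  refine ⟨c', hc', fun m => Finite.equivFinOfCardEq hX (G' m), fun m m' hm i hi => ?_⟩
  obtain ⟨h1, h2⟩ := Prod.ext_iff.1 ((Equiv.injective _) hm)
  rcases Nat.lt_succ_iff_lt_or_eq.1 hi with hi | hi
  · have hne : i ≠ f := fun h => by simp [h, f] at hi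
    rw [hkeep i hne]
    exact hG m m' h1 i hi
  · have hif : i = f := Fin.ext hi
    rw [hif, hg, hg]
    congr 1
    funext j
    rcases lt_trichotomy (j : Fin n) f with hj | hj | hj
    · rw [hG m m' h1 j hj]
    · exact absurd hj (Finset.ne_of_mem_erase j.2)
    · exact congrFun h2 ⟨j, hj⟩

theorem HasSummary.add [Finite Dl] {𝒞 : Set (Fin n → Msg → Sto)} {k t N : ℕ}
    (h𝒞 : IsRegeneratingCode k (n - 1) Dl 𝒞) (h : HasSummary 𝒞 t N) (r : ℕ) (hr : t + r ≤ n) :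
    HasSummary 𝒞 (t + r) (N * Nat.card Dl ^ ∑ i ∈ Finset.range r, (n - 1 - (t + i))) := by
  induction r with
  | zero => simpa using h
  | succ r ih =>
    have := (ih (by omega)).succ h𝒞 (by omega)
    rwa [mul_assoc, ← pow_add, ← Finset.sum_range_succ (fun i => n - 1 - (t + i))] at this

theorem HasSummary.card_le [Finite Msg] {𝒞 : Set (Fin n → Msg → Sto)} {k d N : ℕ}
    (h𝒞 : IsRegeneratingCode k d Dl 𝒞) (h : HasSummary 𝒞 k N) (hk : k ≤ n) :
    Nat.card Msg ≤ N := by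
  obtain ⟨c, hc, G, hG⟩ := h
  obtain ⟨dec, hdec⟩ := h𝒞.recoverable c hc (Finset.univ.filter fun i : Fin n => (i : ℕ) < k)
    (by rw [Fin.card_filter_val_lt, min_eq_right hk])
  have hinj : Function.Injective G := fun m m' hm => by
    rw [← hdec m, ← hdec m']
    congr 1
    funext i
    exact hG m m' hm i (Finset.mem_filter.1 i.2).2
  simpa using Nat.card_le_card_of_injective G hinj

/-- The cut-set bound, with all nodes counted by what they download. -/
theorem IsRegeneratingCode.card_le_pow [Finite Msg] [Finite Dl] {𝒞 : Set (Fin n → Msg → Sto)}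
    {k : ℕ} (h𝒞 : IsRegeneratingCode k (n - 1) Dl 𝒞) (hk : k ≤ n) :
    Nat.card Msg ≤ Nat.card Dl ^ ∑ i ∈ Finset.range k, (n - 1 - i) := by
  have h := (hasSummary_zero h𝒞.nonempty).add h𝒞 k (by omega)
  simp only [zero_add, one_mul] at h
  exact h.card_le h𝒞 hk

/-- The cut-set bound, with the first node counted by what it stores. -/
theorem IsRegeneratingCode.card_le_mul_pow [Finite Msg] [Finite Sto] [Finite Dl]
    {𝒞 : Set (Fin n → Msg → Sto)} {k : ℕ} (h𝒞 : IsRegeneratingCode (k + 1) (n - 1) Dl 𝒞)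
    (hk : k + 1 ≤ n) :
    Nat.card Msg ≤
      Nat.card Sto * Nat.card Dl ^ ∑ i ∈ Finset.range k, (n - 1 - (i + 1)) := by
  have h := (hasSummary_one h𝒞.nonempty (by omega)).add h𝒞 k (by omega)
  simp only [add_comm 1] at h
  exact h.card_le h𝒞 hk

/-- The value `log 0 = 0` makes the case `a = 0` harmless. -/
theorem log_le_log_add_of_le_mul_pow {a b e s : ℕ} (h : a ≤ b * e ^ s) :
    Real.log a ≤ Real.log b + s * Real.log e := by
  rcases Nat.eq_zero_or_pos a with rfl | ha
  · simpa using add_nonneg (Real.log_natCast_nonneg b)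
      (mul_nonneg s.cast_nonneg (Real.log_natCast_nonneg e))
  · have hne : b * e ^ s ≠ 0 := by omega
    rw [← Real.log_pow, ← Real.log_mul (by exact_mod_cast left_ne_zero_of_mul hne)
      (by exact_mod_cast right_ne_zero_of_mul hne)]
    exact Real.log_le_log (by exact_mod_cast ha) (by exact_mod_cast h)

/-- A feasible repair bandwidth `γ` satisfies `B ≤ S * γ / (n - 1)`: by the cut-set bound `B` is at
most `S` times what one helper sends. -/
theorem Feasible.bandwidth_bound {k : ℕ} {B α γ : ℝ} (h : Feasible n k (n - 1) B α γ)
    (hk : k ≤ n) :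
    ((n - 1 : ℕ) : ℝ) * B ≤ ((∑ i ∈ Finset.range k, (n - 1 - i) : ℕ) : ℝ) * γ := by
  obtain ⟨a, b, e, 𝒞, u, hu, h𝒞, hB, -, hγ⟩ := h
  have hlog := log_le_log_add_of_le_mul_pow (b := 1)
    ((h𝒞.card_le_pow hk).trans_eq (one_mul _).symm)
  simp only [Nat.cast_one, Real.log_one, zero_add] at hlog
  refine le_of_mul_le_mul_left ?_ hu
  calc u * (((n - 1 : ℕ) : ℝ) * B) = ((n - 1 : ℕ) : ℝ) * (u * B) := by ring
    _ ≤ ((n - 1 : ℕ) : ℝ) *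
        (((∑ i ∈ Finset.range k, (n - 1 - i) : ℕ) : ℝ) * Real.log (Nat.card (Fin e))) :=
      mul_le_mul_of_nonneg_left (hB.trans hlog) (Nat.cast_nonneg _)
    _ = ((∑ i ∈ Finset.range k, (n - 1 - i) : ℕ) : ℝ) *
        (((n - 1 : ℕ) : ℝ) * Real.log (Nat.card (Fin e))) := by ring
    _ ≤ ((∑ i ∈ Finset.range k, (n - 1 - i) : ℕ) : ℝ) * (u * γ) := by gcongr
    _ = u * (((∑ i ∈ Finset.range k, (n - 1 - i) : ℕ) : ℝ) * γ) := by ring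

/-- A feasible storage `α` at the repair bandwidth `(n - 1) * β` satisfies
`B ≤ α + (S - (n - 1)) * β`; the summand `n - 1` of the node with index `0` is the one left out. -/
theorem Feasible.storage_bound {k : ℕ} {B α β : ℝ}
    (h : Feasible n (k + 1) (n - 1) B α (((n - 1 : ℕ) : ℝ) * β)) (hk : k + 1 ≤ n)
    (hn : 0 < n - 1) :
    B ≤ α + ((∑ i ∈ Finset.range k, (n - 1 - (i + 1)) : ℕ) : ℝ) * β := by
  obtain ⟨a, b, e, 𝒞, u, hu, h𝒞, hB, hα, hγ⟩ := h
  have hlog := log_le_log_add_of_le_mul_pow (h𝒞.card_le_mul_pow hk)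
  have hβ : Real.log (Nat.card (Fin e)) ≤ u * β := by
    refine le_of_mul_le_mul_left ?_ (Nat.cast_pos.2 hn : (0 : ℝ) < ((n - 1 : ℕ) : ℝ))
    linarith
  refine le_of_mul_le_mul_left ?_ hu
  calc u * B ≤ Real.log (Nat.card (Fin b)) +
        ((∑ i ∈ Finset.range k, (n - 1 - (i + 1)) : ℕ) : ℝ) * Real.log (Nat.card (Fin e)) :=
      hB.trans hlog
    _ ≤ u * α + ((∑ i ∈ Finset.range k, (n - 1 - (i + 1)) : ℕ) : ℝ) * (u * β) := by gcongr
    _ = u * (α + ((∑ i ∈ Finset.range k, (n - 1 - (i + 1)) : ℕ) : ℝ) * β) := by ring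

end CutSet

/-! ### Codes over arbitrary finite alphabets -/

section Transport

variable {ι Msg Sto Dl Msg' Sto' Dl' : Type*}

theorem RecoverableFromAny.transport {k : ℕ} {c : ι → Msg → Sto} (h : RecoverableFromAny k c)
    (eM : Msg ≃ Msg') (eS : Sto ≃ Sto') :
    RecoverableFromAny k fun i m => eS (c i (eM.symm m)) := by
  intro K hK
  obtain ⟨dec, hdec⟩ := h K hK
  exact ⟨fun x => eM (dec fun i => eS.symm (x i)), fun m => by simp [hdec]⟩

theorem RepairsTo.transport {c c' : ι → Msg → Sto} {f : ι} {H : Finset ι}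
    (h : RepairsTo Dl c c' f H) (eM : Msg ≃ Msg') (eS : Sto ≃ Sto') (eD : Dl ≃ Dl') :
    RepairsTo Dl' (fun i m => eS (c i (eM.symm m))) (fun i m => eS (c' i (eM.symm m))) f H := by
  obtain ⟨hkeep, snd, g, hg⟩ := h
  refine ⟨fun i hi => by simp only [hkeep i hi], fun i x => eD (snd i (eS.symm x)),
    fun y => eS (g fun i => eD.symm (y i)), fun m => by simp [hg]⟩

theorem IsRegeneratingCode.transport {k d : ℕ} {𝒞 : Set (ι → Msg → Sto)}
    (h : IsRegeneratingCode k d Dl 𝒞) (eM : Msg ≃ Msg') (eS : Sto ≃ Sto') (eD : Dl ≃ Dl') :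
    IsRegeneratingCode k d Dl' ((fun c i m => eS (c i (eM.symm m))) '' 𝒞) where
  nonempty := h.nonempty.image _
  recoverable := by
    rintro _ ⟨c, hc, rfl⟩
    exact (h.recoverable c hc).transport eM eS
  repairable := by
    rintro _ ⟨c, hc, rfl⟩ f H hf hH
    obtain ⟨c', hc', hr⟩ := h.repairable c hc f H hf hH
    exact ⟨_, ⟨c', hc', rfl⟩, hr.transport eM eS eD⟩

theorem OperatesAt.feasible [Finite Msg] [Finite Sto] [Finite Dl] {n k d : ℕ}
    {𝒞 : Set (Fin n → Msg → Sto)} {u B α γ : ℝ} (hu : 0 < u)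
    (h : OperatesAt k d Dl 𝒞 u B α γ) : Feasible n k d B α γ := by
  obtain ⟨h𝒞, hB, hα, hγ⟩ := h
  exact ⟨Nat.card Msg, Nat.card Sto, Nat.card Dl, _, u, hu,
    h𝒞.transport (Finite.equivFin Msg) (Finite.equivFin Sto) (Finite.equivFin Dl),
    by simpa using hB, by simpa using hα, by simpa using hγ⟩

end Transport

/-! ### Recovery and repair in the product-matrix code -/

section ProductMatrix

variable {F : Type*}

/-- A vector supported on the rows `I` that is orthogonal to as many columns is zero. -/
theorem EverySubmatrixFullRank.eq_zero_of_sum_eq_zero [Field F] {a b : ℕ}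
    {Ψ : Matrix (Fin a) (Fin b) F} (hΨ : EverySubmatrixFullRank Ψ) {I : Finset (Fin a)}
    {J : Finset (Fin b)} (hIJ : I.card ≤ J.card) {v : Fin a → F} (hv : ∀ i ∉ I, v i = 0)
    (h : ∀ j ∈ J, ∑ i, Ψ i j * v i = 0) : v = 0 := by
  have hrank := hΨ I J
  rw [min_eq_left hIJ, Matrix.rank_eq_finrank_span_row] at hrank
  have hli : LinearIndependent F
      (Ψ.submatrix (fun i : I => (i : Fin a)) (fun j : J => (j : Fin b))).row :=
    linearIndependent_iff_card_eq_finrank_span.2 (by rw [Set.finrank, hrank, Fintype.card_coe])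
  have hzero := Fintype.linearIndependent_iff.1 hli (fun i => v i) (by
    funext j
    have hj := h j j.2
    rw [← Finset.sum_subset (Finset.subset_univ I) fun i _ hi => by rw [hv i hi, mul_zero],
      ← Finset.sum_coe_sort] at hj
    simpa [Finset.sum_apply, mul_comm] using hj)
  funext i
  by_cases hi : i ∈ I
  · exact hzero ⟨i, hi⟩
  · exact hv i hi

variable {n k B P : ℕ}

theorem messageMatrix_symm [Zero F] (e : Fin P × FreePos n k ≃ Fin B) (m : Fin B → F) (p : Fin P)
    (i j : Fin (n - 1)) : messageMatrix e m p i j = messageMatrix e m p j i := by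
  simp only [messageMatrix, Matrix.of_apply, min_comm i j, max_comm i j]

theorem messageMatrix_eq_zero [Zero F] (e : Fin P × FreePos n k ≃ Fin B) (m : Fin B → F)
    (p : Fin P) {i j : Fin (n - 1)} (hi : k ≤ (i : ℕ)) (hj : k ≤ (j : ℕ)) :
    messageMatrix e m p i j = 0 := by
  rw [messageMatrix, Matrix.of_apply, dif_neg]
  rcases min_choice i j with h | h <;> rw [h] <;> omega

theorem messageMatrix_freePos [Zero F] (e : Fin P × FreePos n k ≃ Fin B) (m : Fin B → F)
    (p : Fin P) (x : FreePos n k) : messageMatrix e m p x.1.1 x.1.2 = m (e (p, x)) := by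
  have hmin : min x.1.1 x.1.2 = x.1.1 := min_eq_left x.2.1
  have hmax : max x.1.1 x.1.2 = x.1.2 := max_eq_right x.2.1
  simp [messageMatrix, hmin, hmax, x.2.2]

theorem eq_of_messageMatrix_eq [Zero F] (e : Fin P × FreePos n k ≃ Fin B) {m m' : Fin B → F}
    (h : ∀ p i j, messageMatrix e m p i j = messageMatrix e m' p i j) : m = m' := by
  funext b
  obtain ⟨⟨p, x⟩, rfl⟩ := e.surjective b
  rw [← messageMatrix_freePos e m, ← messageMatrix_freePos e m', h]

theorem productMatrixCode_apply [CommRing F] (Ψ : Matrix (Fin (n - 1)) (Fin n) F)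
    (e : Fin P × FreePos n k ≃ Fin B) (l : Fin n) (m : Fin B → F) (p : Fin P) (j : Fin (n - 1)) :
    productMatrixCode Ψ e l m p j = ∑ i, Ψ i l * messageMatrix e m p i j := rfl

theorem productMatrixCode_recoverable [Field F] (hkn : k ≤ n - 1)
    {Ψ : Matrix (Fin (n - 1)) (Fin n) F} (hΨ : EverySubmatrixFullRank Ψ)
    (e : Fin P × FreePos n k ≃ Fin B) : RecoverableFromAny k (productMatrixCode Ψ e) := by
  intro K hK
  suffices hinj : Function.Injective
      fun (m : Fin B → F) (i : K) => productMatrixCode Ψ e i m from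
    ⟨Function.invFun _, Function.leftInverse_invFun hinj⟩
  intro m m' hm
  refine eq_of_messageMatrix_eq e fun p => ?_
  let I : Finset (Fin (n - 1)) := Finset.univ.filter fun i => (i : ℕ) < k
  have hI : I.card = k := by rw [Fin.card_filter_val_lt, min_eq_right hkn]
  -- A column of the difference that is supported on the first `k` rows vanishes.
  have hcol : ∀ j, (∀ i : Fin (n - 1), k ≤ (i : ℕ) →
      messageMatrix e m p i j - messageMatrix e m' p i j = 0) →
      ∀ i, messageMatrix e m p i j - messageMatrix e m' p i j = 0 := by
    intro j hj
    refine congrFun (hΨ.eq_zero_of_sum_eq_zero (I := I) (J := K) (by omega)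
      (v := fun i => messageMatrix e m p i j - messageMatrix e m' p i j)
      (fun i hi => hj i (by simpa [I] using hi)) fun l hl => ?_)
    have h := congrFun (congrFun (congrFun hm ⟨l, hl⟩) p) j
    simp only [productMatrixCode_apply] at h
    simp only [mul_sub, Finset.sum_sub_distrib, h, sub_self]
  have hlast : ∀ j : Fin (n - 1), k ≤ (j : ℕ) →
      ∀ i, messageMatrix e m p i j - messageMatrix e m' p i j = 0 := fun j hj =>
    hcol j fun i hi => by rw [messageMatrix_eq_zero e m p hi hj, messageMatrix_eq_zero e m' p hi hj,
      sub_self]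
  refine fun i j => sub_eq_zero.1 (hcol j (fun i hi => ?_) i)
  rw [messageMatrix_symm, messageMatrix_symm e m']
  exact hlast i hi j

theorem productMatrixCode_repairsTo [Field F] {Ψ : Matrix (Fin (n - 1)) (Fin n) F}
    (hΨ : EverySubmatrixFullRank Ψ) (e : Fin P × FreePos n k ≃ Fin B) (f : Fin n)
    {H : Finset (Fin n)} (hH : H.card = n - 1) :
    RepairsTo (Fin P → F) (productMatrixCode Ψ e) (productMatrixCode Ψ e) f H := by
  refine ⟨fun _ _ => rfl, fun _ x p => ∑ j, x p j * Ψ j f, ?_⟩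
  let sent : (Fin B → F) → H → Fin P → F :=
    fun m i p => ∑ j, productMatrixCode Ψ e i m p j * Ψ j f
  suffices hdet : (productMatrixCode Ψ e f).FactorsThrough sent by
    obtain ⟨g, hg⟩ := (Function.factorsThrough_iff _).1 hdet
    exact ⟨g, congrFun hg⟩
  intro m m' hm
  funext p j
  -- By symmetry the lost vector is `M_p ψ_f`, whose product with `ψ_i` is what helper `i` sends.
  let w : (Fin B → F) → Fin (n - 1) → F := fun m j => productMatrixCode Ψ e f m p j
  have hw : ∀ m (l : H), ∑ i, Ψ i l * w m i = sent m l p := by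
    intro m l
    simp only [w, sent, productMatrixCode_apply, Finset.mul_sum, Finset.sum_mul]
    rw [Finset.sum_comm]
    refine Finset.sum_congr rfl fun x _ => Finset.sum_congr rfl fun y _ => ?_
    rw [messageMatrix_symm]
    ring
  refine sub_eq_zero.1 (congrFun (hΨ.eq_zero_of_sum_eq_zero (I := Finset.univ) (J := H)
    (by simp [hH]) (v := fun i => w m i - w m' i) (by simp) fun l hl => ?_) j)
  simp only [mul_sub, Finset.sum_sub_distrib]
  rw [hw m ⟨l, hl⟩, hw m' ⟨l, hl⟩, hm, sub_self]

theorem productMatrixCode_operatesAt [Field F] [Fintype F] (hkn : k ≤ n - 1)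
    {Ψ : Matrix (Fin (n - 1)) (Fin n) F} (hΨ : EverySubmatrixFullRank Ψ)
    (e : Fin P × FreePos n k ≃ Fin B) :
    OperatesAt k (n - 1) (Fin P → F) {productMatrixCode Ψ e} (Real.log (Fintype.card F))
      (B : ℝ) (((n - 1) * P : ℕ) : ℝ) (((n - 1) * P : ℕ) : ℝ) := by
  refine ⟨⟨Set.singleton_nonempty _, ?_, ?_⟩, le_of_eq ?_, le_of_eq ?_, le_of_eq ?_⟩
  · rintro _ rfl
    exact productMatrixCode_recoverable hkn hΨ e
  · rintro _ rfl f H - hH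
    exact ⟨_, rfl, productMatrixCode_repairsTo hΨ e f hH⟩
  · simp [mul_comm]
  · simp
    ring
  · simp
    ring

end ProductMatrix

/-! ### The message size -/

theorem sum_range_sub_add {n k : ℕ} (hkn : k ≤ n - 1) :
    ∑ i ∈ Finset.range k, (n - 1 - i) + ∑ i ∈ Finset.range k, i = k * (n - 1) := by
  rw [← Finset.sum_add_distrib, Finset.sum_congr rfl fun i hi =>
    Nat.sub_add_cancel ((Finset.mem_range.1 hi).le.trans hkn)]
  simp

theorem sum_range_sub_eq {n k : ℕ} (hkn : k ≤ n - 1) :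
    ∑ i ∈ Finset.range k, (n - 1 - i) = k * (n - 1) - k * (k - 1) / 2 := by
  have h := sum_range_sub_add hkn
  rw [← Finset.sum_range_id]
  omega

theorem two_mul_sum_range_sub {n k : ℕ} (hk : 1 ≤ k) (hkn : k ≤ n - 1) :
    2 * ((∑ i ∈ Finset.range k, (n - 1 - i) : ℕ) : ℝ) =
      2 * (k : ℝ) * ((n : ℝ) - 1) - (k : ℝ) ^ 2 + (k : ℝ) := by
  have h := sum_range_sub_add hkn
  have h2 := Finset.sum_range_id_mul_two k
  have h' := congrArg (Nat.cast : ℕ → ℝ) h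
  have h2' := congrArg (Nat.cast : ℕ → ℝ) h2
  rw [Nat.cast_add, Nat.cast_mul, Nat.cast_sub (by omega : 1 ≤ n), Nat.cast_one] at h'
  rw [Nat.cast_mul, Nat.cast_mul, Nat.cast_sub hk, Nat.cast_one, Nat.cast_ofNat] at h2'
  linarith

end ObliviousUpdate

theorem theorem3 {F : Type*} [Field F] [Fintype F] (n k B P : ℕ) (hk : 1 ≤ k) (hkn : k ≤ n - 1)
    (hB : B = P * (k * (n - 1) - k * (k - 1) / 2))
    (Ψ : Matrix (Fin (n - 1)) (Fin n) F) (hΨ : EverySubmatrixFullRank Ψ)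
    (e : Fin P × FreePos n k ≃ Fin B) :
    -- the message can be recovered from the data stored in any `k` nodes
    RecoverableFromAny k (productMatrixCode Ψ e) ∧
    -- the code has exact repair from the `n - 1` other nodes, `P` symbols from each;
    -- storage per node and repair bandwidth are both `(n - 1) * P` symbols
    OperatesAt k (n - 1) (Fin P → F) {productMatrixCode Ψ e} (Real.log (Fintype.card F))
      (B : ℝ) (((n - 1) * P : ℕ) : ℝ) (((n - 1) * P : ℕ) : ℝ) ∧
    -- this is optimal: it is the MBR point of the storage-bandwidth tradeoff
    IsMBRPoint n k (n - 1) (B : ℝ) (((n - 1) * P : ℕ) : ℝ) (((n - 1) * P : ℕ) : ℝ) ∧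
    (((n - 1) * P : ℕ) : ℝ) =
      2 * (B : ℝ) * ((n : ℝ) - 1) / (2 * (k : ℝ) * ((n : ℝ) - 1) - (k : ℝ) ^ 2 + (k : ℝ)) := by
  have hop := productMatrixCode_operatesAt hkn hΨ e
  have hfeas : Feasible n k (n - 1) (B : ℝ) (((n - 1) * P : ℕ) : ℝ) (((n - 1) * P : ℕ) : ℝ) :=
    hop.feasible (Real.log_pos (by exact_mod_cast Fintype.one_lt_card))
  rw [← sum_range_sub_eq hkn] at hB
  have hBS : (B : ℝ) = P * ((∑ i ∈ Finset.range k, (n - 1 - i) : ℕ) : ℝ) := by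
    rw [hB, Nat.cast_mul]
  obtain ⟨r, rfl⟩ : ∃ r, k = r + 1 := ⟨k - 1, by omega⟩
  have hsplit := Finset.sum_range_succ' (fun i => n - 1 - i) r
  have hSpos : (0 : ℝ) < ((∑ i ∈ Finset.range (r + 1), (n - 1 - i) : ℕ) : ℝ) :=
    Nat.cast_pos.2 (by omega)
  refine ⟨productMatrixCode_recoverable hkn hΨ e, hop,
    ⟨⟨hfeas, fun α hα => ?_⟩, ⟨_, hfeas⟩, ?_⟩, ?_⟩
  · have hα' : Feasible n (r + 1) (n - 1) (B : ℝ) α (((n - 1 : ℕ) : ℝ) * P) := by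
      simpa using hα
    have hbound := hα'.storage_bound (by omega) (by omega)
    rw [hBS, hsplit, Nat.cast_add, Nat.sub_zero] at hbound
    rw [Nat.cast_mul]
    linarith
  · rintro γ ⟨α, hγ⟩
    have hbound := hγ.bandwidth_bound (by omega)
    refine le_of_mul_le_mul_left ?_ hSpos
    rw [hBS] at hbound
    rw [Nat.cast_mul]
    linarith
  · rw [← two_mul_sum_range_sub hk hkn, hBS, Nat.cast_mul, Nat.cast_sub (by omega : 1 ≤ n),
      Nat.cast_one]
    field_simp
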